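/- Let $K/k$ be a separable field extension of degree $5$ with Galois closure $\widetilde K/k$, suppose that $\operatorname{Gal}(\widetilde K/k)$ has order $20$, and let $F$ be a field with $K\subsetneq F\subsetneq \widetilde K$. Then $[F:k]=10$, and the extension $F/k$ is Hopf Galois but not almost classically Galois. Moreover, $F/k$ has at least two different Hopf Galois structures, namely one of type $C_{10}$ (the cyclic group of order $10$) and one of type $D_{2\cdot 5}$ (the dihedral group of order $10$). Here a *Hopf Galois structure* on a finite extension $F/k$ is a finite-dimensional cocommutative $k$-Hopf algebra $H$ together with an action of $H$ on $F$ making $F$ an $H$-module algebra, such that the $k$-linear map $j:F\otimes_k H\to \operatorname{End}_k(F)$, $j(s\otimes h)(t)=s\,(h t)$, is bijective; $F/k$ is *Hopf Galois* if it has such a structure. Two structures are regarded as the same if there is an isomorphism of their $k$-Hopf algebras compatible with the actions on $F$. The structure has *type* $N$, for a group $N$, if $\widetilde K\otimes_k H\cong \widetilde K[N]$ as $\widetilde K$-Hopf algebras, where $\widetilde K$ is the Galois closure of $F/k$. Put $G=\operatorname{Gal}(\widetilde K/k)$, $G'=\operatorname{Gal}(\widetilde K/F)$, and let $\lambda:G\to\operatorname{Sym}(G/G')$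 be the action by left multiplication on left cosets; $F/k$ is *almost classically Galois* if there is a regular (that is, simply transitive) subgroup $N$ of $\operatorname{Sym}(G/G')$ which is normalized by $\lambda(G)$ and contained in $\lambda(G)$. -/

import Mathlib

open scoped TensorProduct

universe u v w

noncomputable section

/-- Given a `k`-linear action `act` of `H` on `F`, the `k`-linear map
`j : F ⊗ H → End_k(F)`, `j (s ⊗ h) t = s * (h t)`. -/
def hopfGaloisMap {k : Type u} {F : Type v} {H : Type w} [Field k] [Field F] [Algebra k F]
    [Ring H] [Algebra k H] (act : H →ₐ[k] Module.End k F) :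
    F ⊗[k] H →ₗ[k] Module.End k F :=
  TensorProduct.lift
    (LinearMap.mk₂ k (fun (s : F) (h : H) => LinearMap.mulLeft k s ∘ₗ (act h : F →ₗ[k] F))
      (fun s s' h => by ext t; simp [add_mul])
      (fun c s h => by ext t; simp)
      (fun s h h' => by ext t; simp [mul_add])
      (fun c s h => by ext t; simp))

/-- A Hopf Galois structure on a finite extension of fields `F/k`: a finite cocommutative `k`-Hopf
algebra `H` together with an action of `H` on `F` which makes `F` an `H`-module algebra and for
which the map `j : F ⊗ H → End_k(F)` is bijective.
(The bijectivity of `j` embeds `H` in `End_k(F)`, so there is no loss of generality in taking `H`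
in the universe of `F`.) -/
structure HopfGaloisStructure (k : Type u) (F : Type v) [Field k] [Field F] [Algebra k F] where
  /-- the Hopf algebra -/
  H : Type v
  [ring : Ring H]
  [hopfAlgebra : HopfAlgebra k H]
  [isCocomm : Coalgebra.IsCocomm k H]
  [finite : Module.Finite k H]
  /-- the action of `H` on `F` -/
  act : H →ₐ[k] Module.End k F
  /-- `h 1 = ε(h) 1` -/
  act_one : ∀ h : H, act h 1 = algebraMap k F (Coalgebra.counit (R := k) h)
  /-- `h (x y) = ∑ (h₁ x) (h₂ y)`, where `Δ h = ∑ h₁ ⊗ h₂` -/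
  act_mul : ∀ (h : H) (x y : F), act h (x * y) =
    LinearMap.mul' k F (TensorProduct.map (act.toLinearMap.flip x) (act.toLinearMap.flip y)
      (Coalgebra.comul (R := k) h))
  bijective : Function.Bijective (hopfGaloisMap act)

attribute [instance] HopfGaloisStructure.ring HopfGaloisStructure.hopfAlgebra
  HopfGaloisStructure.isCocomm HopfGaloisStructure.finite

/-- `F/k` is a Hopf Galois extension. -/
def IsHopfGalois (k : Type u) (F : Type v) [Field k] [Field F] [Algebra k F] : Prop :=
  Nonempty (HopfGaloisStructure k F)

namespace HopfGaloisStructure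

variable {k : Type u} {F : Type v} [Field k] [Field F] [Algebra k F]

/-- Two Hopf Galois structures on `F/k` are the same if there is an isomorphism of `k`-Hopf
algebras between them which is compatible with the actions on `F`. (An isomorphism of
bialgebras commutes with the antipodes automatically.) -/
def Equivalent (S T : HopfGaloisStructure k F) : Prop :=
  ∃ e : S.H ≃ₐc[k] T.H, ∀ (h : S.H) (x : F), T.act (e h) x = S.act h x

/-- A Hopf Galois structure with Hopf algebra `H` has type `N` if `E ⊗ H` is isomorphic to the
group algebra `E[N]` as an `E`-Hopf algebra, where `E` is the Galois closure of `F/k`.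
The group `N` is then unique up to isomorphism, being the group of grouplike elements of
`E ⊗ H`. -/
def HasType (S : HopfGaloisStructure k F) (E : Type v) [Field E] [Algebra k E]
    (N : Type w) [Group N] : Prop :=
  Nonempty ((E ⊗[k] S.H) ≃ₐc[E] MonoidAlgebra E N)

end HopfGaloisStructure

/-- A subgroup `N` of `Sym(X)` is regular if it acts simply transitively on `X`. -/
def IsRegularSubgroup {X : Type v} (N : Subgroup (Equiv.Perm X)) : Prop :=
  ∀ x y : X, ∃! n : Equiv.Perm X, n ∈ N ∧ n x = y

/-- `F/k` is almost classically Galois: for `E` the Galois closure of `F/k`, `G = Gal(E/k)`,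
`G' = Gal(E/F)` and `λ : G → Sym(G/G')` the action by left multiplication on left cosets, there
is a regular subgroup `N` of `Sym(G/G')` normalized by `λ(G)` and contained in `λ(G)`. -/
def IsAlmostClassicallyGalois {k : Type u} {E : Type v} [Field k] [Field E] [Algebra k E]
    (F : IntermediateField k E) : Prop :=
  ∃ N : Subgroup (Equiv.Perm ((E ≃ₐ[k] E) ⧸ F.fixingSubgroup)),
    IsRegularSubgroup N ∧
    (MulAction.toPermHom (E ≃ₐ[k] E) ((E ≃ₐ[k] E) ⧸ F.fixingSubgroup)).range ≤
      Subgroup.normalizer (N : Set (Equiv.Perm ((E ≃ₐ[k] E) ⧸ F.fixingSubgroup))) ∧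
    N ≤ (MulAction.toPermHom (E ≃ₐ[k] E) ((E ≃ₐ[k] E) ⧸ F.fixingSubgroup)).range

end

/-! Since $E$ is the Galois closure of $K$, $G=\operatorname{Gal}(E/k)$ acts faithfully on the five
cosets of $\operatorname{Gal}(E/K)$. Having order 20, it is the full affine group of maps $t\mapsto
at+b$ over $\mathbb F_5$ (`Subgroup.exists_affineCoordinates`). There $\operatorname{Gal}(E/K)$ is
the group of homotheties $b=0$, and $G'=\operatorname{Gal}(E/F)$ is its subgroup $a=\pm1$.

Existence is the easy half of Greither–Pareigis theory. A regular subgroup $N$ of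
$\operatorname{Sym}(G/G')$ normalized by $G$ is encoded by an action $\alpha$ of $G$ on $N$ and a
crossed homomorphism $u:G\to N$ whose fibres are the cosets of $G'$ (`IsRegularCocycle`). By Galois
descent (`IsBaseChange.of_fixed_semilinear`) the invariants $E[N]^G$ form a $k$-Hopf algebra with
$E\otimes E[N]^G\cong E[N]$. The field $F$ is identified with the $G$-equivariant functions $N\to
E$, and $E[N]^G$ acts on these by translation. Dedekind independence makes $j$ injective, and a
dimension count makes it bijective. It remains to exhibit explicit cocycles for $C_{10}$ and
$D_{2\cdot5}$. The resulting structures differ because only one of the two Hopf algebras is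
commutative.

A regular $N\le\lambda(G)$ would have index 2, hence contain all squares, in particular $t\mapsto
-t$. This lies in $G'$ and fixes the base coset, which contradicts regularity. -/

/-! ### Galois descent for vector spaces -/

theorem IsBaseChange.of_fixed_semilinear {k : Type*} {E : Type*} {V : Type*} [Field k] [Field E]
    [Algebra k E] [FiniteDimensional k E] [IsGalois k E] [AddCommGroup V] [Module E V] [Module k V]
    [IsScalarTower k E V] (s : ∀ g : E ≃ₐ[k] E, V →ₛₗ[(g : E →+* E)] V)
    (s_one : ∀ v, s 1 v = v) (s_mul : ∀ g h v, s (g * h) v = s g (s h v)) (M : Submodule k V)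
    (hM : ∀ v, v ∈ M ↔ ∀ g, s g v = v) : IsBaseChange E M.subtype := by
  classical
  let b := Module.finBasis k E
  have hsm : ∀ g (e : E) v, s g (e • v) = g e • s g v := fun g e v => (s g).map_smulₛₗ e v
  have htr : ∀ e : E, algebraMap k E (Algebra.trace k E e) = ∑ g : E ≃ₐ[k] E, g e :=
    fun e => trace_eq_sum_automorphisms e
  let L := M.subtype.liftBaseChange E
  have hinj : Function.Injective L := by
    have hexp (x : E ⊗[k] M) : ∃ c : Fin (Module.finrank k E) → M, x = ∑ i, b i ⊗ₜ c i := by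
      induction x with
      | zero => exact ⟨0, by simp⟩
      | tmul e m =>
        refine ⟨fun i => b.repr e i • m, ?_⟩
        conv_lhs => rw [← b.sum_repr e]
        simp only [TensorProduct.sum_tmul, TensorProduct.smul_tmul]
      | add x y hx hy =>
        obtain ⟨c, rfl⟩ := hx
        obtain ⟨d, rfl⟩ := hy
        exact ⟨c + d, by simp [TensorProduct.tmul_add, Finset.sum_add_distrib]⟩
    rw [injective_iff_map_eq_zero]
    intro x hx
    obtain ⟨c, rfl⟩ := hexp x
    have h0 : ∑ i, b i • (c i : V) = 0 := by simpa [L] using hx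
    have h1 : ∀ g : E ≃ₐ[k] E, ∑ i, g (b i) • (c i : V) = 0 := by
      intro g
      have := congrArg (s g) h0
      simpa [map_sum, hsm, (hM _).1 (c _).2 g] using this
    have h2 : ∀ j, c j = 0 := by
      intro j
      -- Weighting the conjugate relations `h1` by the conjugates of the trace-dual vector and
      -- summing over the group isolates `c j`.
      have h3 : ∑ i, (Algebra.trace k E (b.traceDual j * b i)) • (c i : V) = 0 := by
        have : ∀ i, (Algebra.trace k E (b.traceDual j * b i)) • (c i : V)
            = ∑ g : E ≃ₐ[k] E, g (b.traceDual j) • g (b i) • (c i : V) := by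
          intro i
          rw [← IsScalarTower.algebraMap_smul E, htr, Finset.sum_smul]
          simp [mul_smul]
        simp_rw [this]
        rw [Finset.sum_comm]
        simp [← Finset.smul_sum, h1]
      simpa [Module.Basis.trace_traceDual_mul] using h3
    simp [h2]
  have hsurj : Function.Surjective L := by
    rw [← LinearMap.range_eq_top]
    by_contra hne
    obtain ⟨f, hf0, hf⟩ := Submodule.exists_le_ker_of_lt_top _ (lt_top_iff_ne_top.2 hne)
    apply hf0
    ext v
    -- The functional `f` kills the trace of `e • v`, which lies in `M`. As `e` varies this is a
    -- linear relation between automorphisms, so by Dedekind all its coefficients vanish; the one at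
    -- `g = 1` is `f v`.
    have key : ∀ e : E, ∑ g : E ≃ₐ[k] E, f (s g v) * g e = 0 := by
      intro e
      have hmem : ∑ g : E ≃ₐ[k] E, s g (e • v) ∈ M := by
        rw [hM]
        intro g
        simp_rw [map_sum, ← s_mul]
        exact Fintype.sum_equiv (Equiv.mulLeft g) _ _ fun _ => rfl
      have := hf ⟨1 ⊗ₜ ⟨_, hmem⟩, rfl⟩
      simpa [L, hsm, mul_comm] using this
    have hli := Fintype.linearIndependent_iff.1 ((linearIndependent_monoidHom E E).comp
      (fun g : E ≃ₐ[k] E => (g : E →* E)) (fun g h hgh => by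
        ext x; exact DFunLike.congr_fun hgh x)) (fun g => f (s g v)) (by
        ext e; simpa using key e)
    simpa [s_one] using hli 1
  have hbij : Function.Bijective L := ⟨hinj, hsurj⟩
  exact IsBaseChange.of_equiv (LinearEquiv.ofBijective L hbij) fun x => by
    rw [LinearEquiv.ofBijective_apply]
    simp [L]

/-- In an `E`-basis of `V` coming from `M`, the coordinates of a fixed vector are Galois invariant,
hence in `k`. -/
theorem IsBaseChange.mem_range_of_fixed {k : Type*} {E : Type*} {V M : Type*} [Field k] [Field E]
    [Algebra k E] [FiniteDimensional k E] [IsGalois k E] [AddCommGroup V] [Module E V] [Module k V]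
    [IsScalarTower k E V] [AddCommGroup M] [Module k M] {f : M →ₗ[k] V} (hf : IsBaseChange E f)
    (s : ∀ g : E ≃ₐ[k] E, V →ₛₗ[(g : E →+* E)] V) (hs : ∀ g m, s g (f m) = f m)
    {v : V} (hv : ∀ g, s g v = v) : v ∈ LinearMap.range f := by
  let b := Module.Basis.ofVectorSpace k M
  let B := hf.basis b
  have hB : ∀ i, B i = f (b i) := hf.basis_apply b
  have hfix : ∀ i, ∃ c : k, algebraMap k E c = B.repr v i := by
    intro i
    refine (IsGalois.mem_range_algebraMap_iff_fixed _).2 fun g => ?_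
    have h1 : B.repr v = (B.repr v).mapRange g (map_zero g) := by
      rw [← B.repr_linearCombination (Finsupp.mapRange _ _ _)]
      congr 1
      conv_lhs => rw [← hv g, ← B.linearCombination_repr v]
      rw [Finsupp.linearCombination_apply, Finsupp.linearCombination_apply,
        Finsupp.sum_mapRange_index (by simp), Finsupp.sum, map_sum]
      refine Finset.sum_congr rfl fun i _ => ?_
      beta_reduce
      rw [LinearMap.map_smulₛₗ, hB, hs]
      rfl
    exact (DFunLike.congr_fun h1 i).symm
  choose c hc using hfix
  rw [← B.linearCombination_repr v, Finsupp.linearCombination_apply]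
  refine Submodule.sum_mem _ fun i _ => ?_
  beta_reduce
  rw [← hc, hB, algebraMap_smul]
  exact ⟨c i • b i, map_smul _ _ _⟩

theorem IsBaseChange.injective_of_field {k : Type*} {E : Type*} {V M : Type*} [Field k] [Field E]
    [Algebra k E] [AddCommGroup V] [Module E V] [Module k V]
    [IsScalarTower k E V] [AddCommGroup M] [Module k M] {f : M →ₗ[k] V} (hf : IsBaseChange E f) :
    Function.Injective f := by
  intro x y hxy
  apply Module.FaithfullyFlat.tensorProduct_mk_injective (A := k) (B := E) M
  apply hf.equiv.injective
  simpa [IsBaseChange.equiv_tmul] using hxy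

/-! ### Tensor products and base change -/

section TensorMap

variable {k E V W M N : Type*} [Field k] [Field E] [Algebra k E]
  [AddCommGroup V] [Module E V] [Module k V] [IsScalarTower k E V]
  [AddCommGroup W] [Module E W] [Module k W] [IsScalarTower k E W]
  [AddCommGroup M] [Module k M] [AddCommGroup N] [Module k N]

/-- The map `M ⊗[k] N → V ⊗[E] W` induced by `k`-linear maps `M → V` and `N → W` into
modules over an extension `E` of `k`. -/
noncomputable def TensorProduct.mapExtend (f : M →ₗ[k] V) (g : N →ₗ[k] W) :
    M ⊗[k] N →ₗ[k] V ⊗[E] W :=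
  TensorProduct.lift (LinearMap.mk₂ k (fun m n => f m ⊗ₜ[E] g n)
    (fun _ _ _ => by simp [TensorProduct.add_tmul])
    (fun _ _ _ => by simp [TensorProduct.smul_tmul'])
    (fun _ _ _ => by simp [TensorProduct.tmul_add])
    (fun c m n => by
      rw [map_smul, ← algebraMap_smul E c (g n), TensorProduct.tmul_smul, algebraMap_smul]))

@[simp]
theorem TensorProduct.mapExtend_tmul (f : M →ₗ[k] V) (g : N →ₗ[k] W) (m : M) (n : N) :
    TensorProduct.mapExtend (E := E) f g (m ⊗ₜ n) = f m ⊗ₜ g n := rfl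

theorem IsBaseChange.mapExtend {f : M →ₗ[k] V} {g : N →ₗ[k] W} (hf : IsBaseChange E f)
    (hg : IsBaseChange E g) : IsBaseChange E (TensorProduct.mapExtend (E := E) f g) := by
  refine IsBaseChange.of_equiv ((TensorProduct.AlgebraTensorModule.distribBaseChange k E M N).trans
    (TensorProduct.congr hf.equiv hg.equiv)) fun x => ?_
  induction x with
  | zero => simp
  | tmul m n => simp [IsBaseChange.equiv_tmul]
  | add x y hx hy => simp only [TensorProduct.tmul_add, map_add, hx, hy]

end TensorMap

/-! ### Descent of Hopf algebra structures -/

/-- A `k`-form of a Hopf algebra `A` over an extension `E` of `k`: a `k`-subalgebra `S` of `A` with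
`E ⊗ S ≅ A` which is stable under the Hopf algebra operations. -/
structure IsHopfForm {k E A : Type*} [Field k] [Field E] [Algebra k E] [Ring A] [HopfAlgebra E A]
    [Algebra k A] [IsScalarTower k E A] (S : Subalgebra k A) : Prop where
  isBaseChange : IsBaseChange E S.val.toLinearMap
  comul_mem : ∀ h : S, Coalgebra.comul (R := E) (h : A) ∈
    LinearMap.range (TensorProduct.mapExtend (E := E) S.val.toLinearMap S.val.toLinearMap)
  counit_mem : ∀ h : S, Coalgebra.counit (R := E) (h : A) ∈ (algebraMap k E).range
  antipode_mem : ∀ h : S, HopfAlgebra.antipode E (h : A) ∈ S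

namespace IsHopfForm

variable {k E A : Type*} [Field k] [Field E] [Algebra k E] [Ring A] [HopfAlgebra E A]
    [Algebra k A] [IsScalarTower k E A] {S : Subalgebra k A}

variable (E S) in
/-- The canonical algebra map `S ⊗[k] S → A ⊗[E] A`. -/
noncomputable def tensorIncl : S ⊗[k] S →ₐ[k] A ⊗[E] A :=
  Algebra.TensorProduct.lift
    ((Algebra.TensorProduct.includeLeft : A →ₐ[k] A ⊗[E] A).comp S.val)
    (((Algebra.TensorProduct.includeRight : A →ₐ[E] A ⊗[E] A).restrictScalars k).comp S.val)
    (fun x y => by simp [Commute, SemiconjBy])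

@[simp]
theorem tensorIncl_tmul (x y : S) : tensorIncl E S (x ⊗ₜ y) = (x : A) ⊗ₜ (y : A) :=
  (Algebra.TensorProduct.lift_tmul _ _ _ _ _).trans (by simp)

theorem mapExtend_eq (x : S ⊗[k] S) :
    TensorProduct.mapExtend (E := E) S.val.toLinearMap S.val.toLinearMap x = tensorIncl E S x := by
  induction x with
  | zero => simp
  | tmul x y => simp
  | add x y hx hy => simp only [map_add, hx, hy]

variable (E S) in
/-- The inclusion `S ⊗ (S ⊗ S) → A ⊗ (A ⊗ A)`. -/
noncomputable def tensorIncl₃ : S ⊗[k] (S ⊗[k] S) →ₗ[k] A ⊗[E] (A ⊗[E] A) :=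
  TensorProduct.mapExtend S.val.toLinearMap (tensorIncl E S).toLinearMap

variable (E S) in
/-- The canonical algebra map `E ⊗[k] S → A`. -/
noncomputable def baseChangeHom : E ⊗[k] S →ₐ[E] A :=
  Algebra.TensorProduct.lift (Algebra.ofId E A) S.val (fun e _ => Algebra.commutes e _)

theorem baseChangeHom_tmul (e : E) (s : S) : baseChangeHom E S (e ⊗ₜ s) = e • (s : A) :=
  (Algebra.TensorProduct.lift_tmul _ _ _ _ _).trans (Algebra.smul_def _ _).symm

variable (hS : IsHopfForm (E := E) S)
include hS

/-- Thanks to this injectivity and its threefold analogue, the operations of `A` restrict to `S` and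
the Hopf axioms for `S` can be checked in tensor powers of `A`. -/
theorem tensorIncl_injective : Function.Injective (tensorIncl E S) := fun x y hxy =>
  (hS.isBaseChange.mapExtend hS.isBaseChange).injective_of_field (by simpa [mapExtend_eq])

theorem tensorIncl₃_injective : Function.Injective (tensorIncl₃ E S) := by
  have h : (tensorIncl E S).toLinearMap =
    TensorProduct.mapExtend (E := E) S.val.toLinearMap S.val.toLinearMap :=
      LinearMap.ext fun x => (mapExtend_eq x).symm
  rw [tensorIncl₃, h]
  exact (hS.isBaseChange.mapExtend (hS.isBaseChange.mapExtend hS.isBaseChange)).injective_of_field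

/-- The comultiplication of a form. -/
noncomputable def comul : S →ₗ[k] S ⊗[k] S :=
  (LinearEquiv.ofInjective (tensorIncl E S).toLinearMap hS.tensorIncl_injective).symm.toLinearMap ∘ₗ
    LinearMap.codRestrict _ ((Coalgebra.comul (R := E) (A := A)).restrictScalars k ∘ₗ
      S.val.toLinearMap) (fun h => by
        obtain ⟨x, hx⟩ := hS.comul_mem h
        exact ⟨x, by simpa [mapExtend_eq] using hx⟩)

theorem tensorIncl_comul (h : S) :
    tensorIncl E S (hS.comul h) = Coalgebra.comul (R := E) (h : A) := by
  change ((LinearEquiv.ofInjective (tensorIncl E S).toLinearMap hS.tensorIncl_injective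
    (hS.comul h) : _) : A ⊗[E] A) = _
  rw [comul, LinearMap.comp_apply, LinearEquiv.coe_coe, LinearEquiv.apply_symm_apply]
  rfl

/-- The counit of a form. -/
noncomputable def counit : S →ₗ[k] k :=
  (LinearEquiv.ofInjective (Algebra.linearMap k E) (algebraMap k E).injective).symm.toLinearMap ∘ₗ
    LinearMap.codRestrict _ ((Coalgebra.counit (R := E) (A := A)).restrictScalars k ∘ₗ
      S.val.toLinearMap) hS.counit_mem

theorem algebraMap_counit (h : S) :
    algebraMap k E (hS.counit h) = Coalgebra.counit (R := E) (h : A) := by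
  change ((LinearEquiv.ofInjective (Algebra.linearMap k E) (algebraMap k E).injective
    (hS.counit h) : _) : E) = _
  rw [counit, LinearMap.comp_apply, LinearEquiv.coe_coe, LinearEquiv.apply_symm_apply]
  rfl

/-- The antipode of a form. -/
noncomputable def antipode : S →ₗ[k] S :=
  LinearMap.codRestrict (Subalgebra.toSubmodule S)
    ((HopfAlgebra.antipode E (A := A)).restrictScalars k ∘ₗ S.val.toLinearMap) hS.antipode_mem

@[simp]
theorem coe_antipode (h : S) : (hS.antipode h : A) = HopfAlgebra.antipode E (h : A) := rfl

set_option synthInstance.maxHeartbeats 200000 in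
/-- The coalgebra structure of a form. -/
@[reducible]
noncomputable def coalgebra : Coalgebra k S where
  comul := hS.comul
  counit := hS.counit
  coassoc := by
    ext h
    apply hS.tensorIncl₃_injective
    have h1 : ∀ x : S ⊗[k] S, tensorIncl₃ E S (TensorProduct.assoc k S S S
        (hS.comul.rTensor S x)) = TensorProduct.assoc E A A A
          ((Coalgebra.comul (R := E)).rTensor A (tensorIncl E S x)) := by
      have h2 : ∀ (x : S ⊗[k] S) (b : S), tensorIncl₃ E S (TensorProduct.assoc k S S S (x ⊗ₜ b)) =
          TensorProduct.assoc E A A A (tensorIncl E S x ⊗ₜ (b : A)) := by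
        intro x b
        induction x with
        | zero => simp
        | tmul x y => simp [tensorIncl₃]
        | add x y hx hy => simp only [map_add, TensorProduct.add_tmul, hx, hy]
      intro x
      induction x with
      | zero => simp
      | tmul a b => simp [h2, tensorIncl_comul]
      | add x y hx hy => simp only [map_add, hx, hy]
    have h3 : ∀ x : S ⊗[k] S, tensorIncl₃ E S (hS.comul.lTensor S x) =
        (Coalgebra.comul (R := E)).lTensor A (tensorIncl E S x) := by
      intro x
      induction x with
      | zero => simp
      | tmul a b => simp [tensorIncl₃, tensorIncl_comul]
      | add x y hx hy => simp only [map_add, hx, hy]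
    simp only [LinearMap.comp_apply, LinearEquiv.coe_coe]
    rw [h1, h3, tensorIncl_comul, Coalgebra.coassoc_apply]
  rTensor_counit_comp_comul := by
    ext h
    apply (TensorProduct.lid k S).injective
    apply Subtype.val_injective
    have h1 : ∀ x : S ⊗[k] S, (TensorProduct.lid k S (hS.counit.rTensor S x) : A) =
        TensorProduct.lid E A ((Coalgebra.counit (R := E)).rTensor A (tensorIncl E S x)) := by
      intro x
      induction x with
      | zero => simp
      | tmul a b => simp [← algebraMap_counit hS]
      | add x y hx hy => simp only [map_add, hx, hy, Subalgebra.coe_add]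
    rw [LinearMap.comp_apply, h1, tensorIncl_comul, Coalgebra.rTensor_counit_comul]
    simp
  lTensor_counit_comp_comul := by
    ext h
    apply (TensorProduct.rid k S).injective
    apply Subtype.val_injective
    have h1 : ∀ x : S ⊗[k] S, (TensorProduct.rid k S (hS.counit.lTensor S x) : A) =
        TensorProduct.rid E A ((Coalgebra.counit (R := E)).lTensor A (tensorIncl E S x)) := by
      intro x
      induction x with
      | zero => simp
      | tmul a b => simp [← algebraMap_counit hS]
      | add x y hx hy => simp only [map_add, hx, hy, Subalgebra.coe_add]
    rw [LinearMap.comp_apply, h1, tensorIncl_comul, Coalgebra.lTensor_counit_comul]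
    simp

/-- The bialgebra structure of a form. -/
@[reducible]
noncomputable def bialgebra : Bialgebra k S :=
  letI := hS.coalgebra
  Bialgebra.mk' k S
    ((algebraMap k E).injective <| by
      change algebraMap k E (hS.counit 1) = _
      simp [algebraMap_counit])
    (fun {a b} => (algebraMap k E).injective <| by
      change algebraMap k E (hS.counit _) = algebraMap k E (hS.counit _ * hS.counit _)
      simp [algebraMap_counit])
    (hS.tensorIncl_injective <| by
      change tensorIncl E S (hS.comul 1) = _
      simp [tensorIncl_comul])
    (fun {a b} => hS.tensorIncl_injective <| by
      change tensorIncl E S (hS.comul _) = tensorIncl E S (hS.comul _ * hS.comul _)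
      simp [tensorIncl_comul])

/-- The Hopf algebra structure of a form. -/
@[reducible]
noncomputable def hopfAlgebra : HopfAlgebra k S :=
  letI := hS.bialgebra
  { antipode := hS.antipode
    mul_antipode_rTensor_comul := by
      ext h
      have h1 : ∀ x : S ⊗[k] S, (LinearMap.mul' k S (hS.antipode.rTensor S x) : A) =
          LinearMap.mul' E A ((HopfAlgebra.antipode E).rTensor A (tensorIncl E S x)) := by
        intro x
        induction x with
        | zero => simp
        | tmul a b => simp
        | add x y hx hy => simp only [map_add, hx, hy, Subalgebra.coe_add]
      change (LinearMap.mul' k S (hS.antipode.rTensor S (hS.comul h)) : A) =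
        (algebraMap k S (hS.counit h) : S)
      rw [h1, tensorIncl_comul, HopfAlgebra.mul_antipode_rTensor_comul_apply,
        ← algebraMap_counit hS, ← IsScalarTower.algebraMap_apply]
      rfl
    mul_antipode_lTensor_comul := by
      ext h
      have h1 : ∀ x : S ⊗[k] S, (LinearMap.mul' k S (hS.antipode.lTensor S x) : A) =
          LinearMap.mul' E A ((HopfAlgebra.antipode E).lTensor A (tensorIncl E S x)) := by
        intro x
        induction x with
        | zero => simp
        | tmul a b => simp
        | add x y hx hy => simp only [map_add, hx, hy, Subalgebra.coe_add]
      change (LinearMap.mul' k S (hS.antipode.lTensor S (hS.comul h)) : A) =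
        (algebraMap k S (hS.counit h) : S)
      rw [h1, tensorIncl_comul, HopfAlgebra.mul_antipode_lTensor_comul_apply,
        ← algebraMap_counit hS, ← IsScalarTower.algebraMap_apply]
      rfl }

theorem isCocomm [Coalgebra.IsCocomm E A] :
    letI := hS.hopfAlgebra
    Coalgebra.IsCocomm k S :=
  letI := hS.hopfAlgebra
  { comm_comp_comul := by
      ext h
      apply hS.tensorIncl_injective
      have h1 : ∀ x : S ⊗[k] S, tensorIncl E S (TensorProduct.comm k S S x) =
          TensorProduct.comm E A A (tensorIncl E S x) := by
        intro x
        induction x with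
        | zero => simp
        | tmul a b => simp
        | add x y hx hy => simp only [map_add, hx, hy]
      change tensorIncl E S (TensorProduct.comm k S S (hS.comul h)) = tensorIncl E S (hS.comul h)
      rw [h1, tensorIncl_comul, Coalgebra.comm_comul] }

theorem baseChangeHom_bijective : Function.Bijective (baseChangeHom E S) := by
  convert hS.isBaseChange.equiv.bijective
  ext x
  induction x with
  | zero => simp
  | tmul a b => simp [baseChangeHom_tmul, IsBaseChange.equiv_tmul]
  | add x y hx hy => simp only [map_add, hx, hy]

set_option synthInstance.maxHeartbeats 200000 in
/-- Extending scalars in a form gives back the Hopf algebra. -/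
noncomputable def baseChangeEquiv :
    letI := hS.hopfAlgebra
    (E ⊗[k] S) ≃ₐc[E] A :=
  letI := hS.hopfAlgebra
  BialgEquiv.ofAlgEquiv (AlgEquiv.ofBijective (baseChangeHom E S) hS.baseChangeHom_bijective)
    (by
      ext h
      have h1 : algebraMap k E (Coalgebra.counit (R := k) h) = Coalgebra.counit (R := E) (h : A) :=
        hS.algebraMap_counit h
      simpa [baseChangeHom_tmul] using h1.symm)
    (by
      ext h
      have h1 : ∀ x : S ⊗[k] S, Algebra.TensorProduct.map (baseChangeHom E S) (baseChangeHom E S)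
          (TensorProduct.AlgebraTensorModule.tensorTensorTensorComm k E k E E E S S
            ((1 ⊗ₜ[E] 1) ⊗ₜ[k] x)) = tensorIncl E S x := by
        intro x
        induction x with
        | zero => simp
        | tmul a b => simp [baseChangeHom_tmul]
        | add x y hx hy => simp only [TensorProduct.tmul_add, map_add, hx, hy]
      have h2 : Algebra.TensorProduct.map (baseChangeHom E S) (baseChangeHom E S)
          (TensorProduct.AlgebraTensorModule.tensorTensorTensorComm k E k E E E S S
            ((1 ⊗ₜ[E] 1) ⊗ₜ[k] Coalgebra.comul (R := k) h)) = Coalgebra.comul (R := E) (h : A) :=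
        (h1 (hS.comul h)).trans (hS.tensorIncl_comul h)
      simpa [baseChangeHom_tmul] using h2)

end IsHopfForm

/-! ### The twisted form of a group algebra -/

theorem finrank_monoidAlgebra {E N : Type*} [Field E] [Finite N] :
    Module.finrank E (MonoidAlgebra E N) = Nat.card N := by
  have := Fintype.ofFinite N
  rw [(MonoidAlgebra.coeffLinearEquiv E : MonoidAlgebra E N ≃ₗ[E] _).finrank_eq,
    Module.finrank_finsupp_self, Nat.card_eq_fintype_card]

section GroupAlgebraForm

variable {k E N : Type*} [Field k] [Field E] [Algebra k E] [Group N] (α : (E ≃ₐ[k] E) →* MulAut N)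

/-- The action of a Galois automorphism on `E[N]`, by the Galois action on the coefficients and a
given action by group automorphisms on `N`. -/
noncomputable def groupAlgebraTwist (g : E ≃ₐ[k] E) :
    MonoidAlgebra E N →ₛₗ[(g : E →+* E)] MonoidAlgebra E N where
  toFun := (MonoidAlgebra.mapRingHom N (g : E →+* E)).comp
    (MonoidAlgebra.mapDomainRingHom E (α g : N →* N))
  map_add' := map_add _
  map_smul' e a := by
    induction a using MonoidAlgebra.induction_linear with
    | zero => simp
    | add x y hx hy => simp only [smul_add, map_add, hx, hy]
    | single n c => simp

@[simp]
theorem groupAlgebraTwist_single (g : E ≃ₐ[k] E) (n : N) (c : E) :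
    groupAlgebraTwist α g (MonoidAlgebra.single n c) = MonoidAlgebra.single (α g n) (g c) := by
  simp [groupAlgebraTwist]

theorem groupAlgebraTwist_map_mul (g : E ≃ₐ[k] E) (a b : MonoidAlgebra E N) :
    groupAlgebraTwist α g (a * b) = groupAlgebraTwist α g a * groupAlgebraTwist α g b :=
  map_mul ((MonoidAlgebra.mapRingHom N (g : E →+* E)).comp
    (MonoidAlgebra.mapDomainRingHom E (α g : N →* N))) a b

theorem groupAlgebraTwist_one (a : MonoidAlgebra E N) : groupAlgebraTwist α 1 a = a := by
  induction a using MonoidAlgebra.induction_linear with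
  | zero => simp
  | add x y hx hy => simp only [map_add, hx, hy]
  | single n c => simp

theorem groupAlgebraTwist_mul (g h : E ≃ₐ[k] E) (a : MonoidAlgebra E N) :
    groupAlgebraTwist α (g * h) a = groupAlgebraTwist α g (groupAlgebraTwist α h a) := by
  induction a using MonoidAlgebra.induction_linear with
  | zero => simp
  | add x y hx hy => simp only [map_add, hx, hy]
  | single n c => simp

/-- The algebra `E[N]^G` of elements of `E[N]` fixed by the Galois group. -/
noncomputable def groupAlgebraFixed : Subalgebra k (MonoidAlgebra E N) where
  carrier := {a | ∀ g, groupAlgebraTwist α g a = a}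
  mul_mem' ha hb g := by rw [groupAlgebraTwist_map_mul, ha g, hb g]
  add_mem' ha hb g := by rw [map_add, ha g, hb g]
  algebraMap_mem' r g := by
    simp [IsScalarTower.algebraMap_apply k E (MonoidAlgebra E N)]

theorem groupAlgebraFixed_finite [FiniteDimensional k E] [Finite N] :
    Module.Finite k (groupAlgebraFixed α) := by
  have : Module.Finite E (MonoidAlgebra E N) :=
    Module.Finite.equiv (MonoidAlgebra.coeffLinearEquiv E).symm
  have : Module.Finite k (MonoidAlgebra E N) := Module.Finite.trans E _
  exact Module.Finite.of_injective (groupAlgebraFixed α).val.toLinearMap Subtype.val_injective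

variable [FiniteDimensional k E] [IsGalois k E]

theorem groupAlgebraFixed_isBaseChange :
    IsBaseChange E (groupAlgebraFixed α).val.toLinearMap :=
  IsBaseChange.of_fixed_semilinear (groupAlgebraTwist α) (groupAlgebraTwist_one α)
    (groupAlgebraTwist_mul α) (Subalgebra.toSubmodule (groupAlgebraFixed α)) fun _ => Iff.rfl

/-- The Hopf operations of `E[N]` commute with the twisted Galois action, so they send invariants to
invariants; by descent the invariants of `E[N] ⊗ E[N]` come from the tensor square of the form. -/
theorem groupAlgebraFixed_isHopfForm : IsHopfForm (E := E) (groupAlgebraFixed α) where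
  isBaseChange := groupAlgebraFixed_isBaseChange α
  comul_mem h := by
    refine IsBaseChange.mem_range_of_fixed (k := k) (E := E)
      (V := MonoidAlgebra E N ⊗[E] MonoidAlgebra E N)
      (f := TensorProduct.mapExtend (groupAlgebraFixed α).val.toLinearMap
        (groupAlgebraFixed α).val.toLinearMap)
      ((groupAlgebraFixed_isBaseChange α).mapExtend (groupAlgebraFixed_isBaseChange α))
      (fun g => TensorProduct.map (groupAlgebraTwist α g) (groupAlgebraTwist α g)) ?_ ?_
    · intro g x
      induction x with
      | zero => simp
      | tmul a b => simp [a.2 g, b.2 g]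
      | add x y hx hy => simp only [map_add, hx, hy]
    · intro g
      have key : ∀ a : MonoidAlgebra E N,
          TensorProduct.map (groupAlgebraTwist α g) (groupAlgebraTwist α g)
            (Coalgebra.comul (R := E) a) = Coalgebra.comul (R := E) (groupAlgebraTwist α g a) := by
        intro a
        induction a using MonoidAlgebra.induction_linear with
        | zero => simp
        | add x y hx hy => simp only [map_add, hx, hy]
        | single n c => simp
      rw [key, h.2 g]
  counit_mem h := by
    refine (IsGalois.mem_range_algebraMap_iff_fixed _).2 fun g => ?_
    have key : ∀ a : MonoidAlgebra E N, g (Coalgebra.counit (R := E) a) =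
        Coalgebra.counit (R := E) (groupAlgebraTwist α g a) := by
      intro a
      induction a using MonoidAlgebra.induction_linear with
      | zero => simp
      | add x y hx hy => simp only [map_add, hx, hy]
      | single n c => simp
    rw [key, h.2 g]
  antipode_mem h g := by
    have key : ∀ a : MonoidAlgebra E N, groupAlgebraTwist α g (HopfAlgebra.antipode E a) =
        HopfAlgebra.antipode E (groupAlgebraTwist α g a) := by
      intro a
      induction a using MonoidAlgebra.induction_linear with
      | zero => simp
      | add x y hx hy => simp only [map_add, hx, hy]
      | single n c => simp
    rw [key, h.2 g]

theorem finrank_groupAlgebraFixed [Finite N] :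
    Module.finrank k (groupAlgebraFixed α) = Nat.card N := by
  have h := (groupAlgebraFixed_isBaseChange α).equiv.finrank_eq
  rwa [Module.finrank_baseChange, finrank_monoidAlgebra] at h

end GroupAlgebraForm

/-! ### The group algebra acting on functions by translation -/

section Translation

variable (E N : Type*) [Field E] [Group N]

/-- The action of `E[N]` on functions on `N`, in which `N` acts by left translation. -/
noncomputable def leftTranslation : MonoidAlgebra E N →ₐ[E] Module.End E (N → E) :=
  MonoidAlgebra.lift E (Module.End E (N → E)) N
    { toFun := fun n => LinearMap.funLeft E E (n⁻¹ * ·)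
      map_one' := by ext; simp
      map_mul' := fun m n => by
        refine LinearMap.ext fun f => funext fun p => ?_
        simp [LinearMap.funLeft_apply, mul_assoc] }

variable {E N}

@[simp]
theorem leftTranslation_single (n : N) (c : E) (f : N → E) (p : N) :
    leftTranslation E N (MonoidAlgebra.single n c) f p = c * f (n⁻¹ * p) := by
  simp [leftTranslation, LinearMap.funLeft_apply]

/-- The substitution `m = n⁻¹ * p` exhibits the value at `p` as a combination of the values `f m`,
the shape to which Dedekind independence applies. -/
theorem leftTranslation_apply [Fintype N] (a : MonoidAlgebra E N) (f : N → E) (p : N) :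
    leftTranslation E N a f p = ∑ m, a.coeff (p * m⁻¹) * f m := by
  classical
  induction a using MonoidAlgebra.induction_linear with
  | zero => simp
  | add x y hx hy => simp [hx, hy, add_mul, Finset.sum_add_distrib]
  | single n c =>
    rw [leftTranslation_single, Finset.sum_eq_single (n⁻¹ * p)]
    · simp
    · intro m _ hm
      rw [MonoidAlgebra.coeff_single, Finsupp.single_apply, if_neg, zero_mul]
      rintro rfl
      simp at hm
    · simp

theorem leftTranslation_mul_apply (a : MonoidAlgebra E N) (x y : N → E) :
    leftTranslation E N a (x * y) =
      LinearMap.mul' E (N → E) (TensorProduct.map ((leftTranslation E N).toLinearMap.flip x)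
        ((leftTranslation E N).toLinearMap.flip y) (Coalgebra.comul (R := E) a)) := by
  induction a using MonoidAlgebra.induction_linear with
  | zero => simp
  | add a b ha hb => simp only [map_add, LinearMap.add_apply, ha, hb]
  | single n c => ext p; simp; ring

theorem leftTranslation_const (a : MonoidAlgebra E N) :
    leftTranslation E N a 1 = fun _ => Coalgebra.counit (R := E) a := by
  induction a using MonoidAlgebra.induction_linear with
  | zero => ext; simp
  | add a b ha hb => simp only [map_add, LinearMap.add_apply, ha, hb]; rfl
  | single n c => ext p; simp

end Translation

/-! ### From a regular cocycle to a Hopf Galois structure -/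

/-- Given `F` between `k` and a Galois extension `E`, an action `α` of `Gal(E/k)` on a group `N`, a
crossed homomorphism `u` for `α` inducing a bijection of `Gal(E/k)/Gal(E/F)` with `N`. Equivalently,
`N` is identified with a regular subgroup of `Sym(Gal(E/k)/Gal(E/F))` normalized by
`Gal(E/k)`. -/
structure IsRegularCocycle {k E N : Type*} [Field k] [Field E] [Algebra k E] [Group N]
    (F : IntermediateField k E) (α : (E ≃ₐ[k] E) →* MulAut N) (u : (E ≃ₐ[k] E) → N) : Prop where
  map_mul : ∀ g h, u (g * h) = α g (u h) * u g
  surjective : Function.Surjective u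
  eq_one_iff : ∀ g, u g = 1 ↔ g ∈ F.fixingSubgroup

namespace IsRegularCocycle

variable {k E N : Type*} [Field k] [Field E] [Algebra k E] [Group N]
  {F : IntermediateField k E} {α : (E ≃ₐ[k] E) →* MulAut N} {u : (E ≃ₐ[k] E) → N}

/-- The map `n ↦ α g n * u g` is the action of `g` on cosets carried over to `N`. It conjugates left
translation by `m` into left translation by `α g m`, because `u g` multiplies on the right. -/
theorem leftTranslation_equivariant {f : N → E} (hf : ∀ g n, f (α g n * u g) = g (f n))
    (a : MonoidAlgebra E N) (g : E ≃ₐ[k] E) (n : N) :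
    leftTranslation E N (groupAlgebraTwist α g a) f (α g n * u g) =
      g (leftTranslation E N a f n) := by
  induction a using MonoidAlgebra.induction_linear with
  | zero => simp
  | add x y hx hy => simp only [map_add, LinearMap.add_apply, Pi.add_apply, hx, hy]
  | single m c => simp [← hf, mul_assoc]

variable (hu : IsRegularCocycle F α u)
include hu

theorem map_one : u 1 = 1 := (hu.eq_one_iff 1).2 (one_mem _)

theorem apply_eq_of_eq {g h : E ≃ₐ[k] E} (hgh : u g = u h) (t : F) : g t = h t := by
  have h1 := hu.map_mul g (g⁻¹ * h)
  rw [mul_inv_cancel_left, hgh, right_eq_mul, EmbeddingLike.map_eq_one_iff, hu.eq_one_iff] at h1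
  have h2 := congrArg g (h1 t)
  simpa using h2.symm

/-- The embedding of `F` in the functions from `N` to `E`, given by the Galois conjugates. -/
noncomputable def conjugates : F →ₐ[k] (N → E) :=
  AlgHom.pi fun n => ((Function.surjInv hu.surjective n : E ≃ₐ[k] E) : E →ₐ[k] E).comp F.val

theorem conjugates_apply (t : F) (g : E ≃ₐ[k] E) : hu.conjugates t (u g) = g t :=
  hu.apply_eq_of_eq (Function.surjInv_eq hu.surjective (u g)) t

theorem conjugates_one (t : F) : hu.conjugates t 1 = t := by
  simpa [hu.map_one] using hu.conjugates_apply t 1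

theorem conjugates_injective : Function.Injective hu.conjugates := fun s t hst =>
  Subtype.val_injective <| by rw [← hu.conjugates_one s, hst, hu.conjugates_one]

theorem conjugates_equivariant (t : F) (g : E ≃ₐ[k] E) (n : N) :
    hu.conjugates t (α g n * u g) = g (hu.conjugates t n) := by
  obtain ⟨h, rfl⟩ := hu.surjective n
  rw [← hu.map_mul, conjugates_apply, conjugates_apply, AlgEquiv.mul_apply]

/-- The stabilizer of `1 : N` is `Gal(E/F)`, so equivariance makes `f 1` invariant under it. -/
theorem mem_of_equivariant [FiniteDimensional k E] [IsGalois k E] {f : N → E}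
    (hf : ∀ g n, f (α g n * u g) = g (f n)) : f 1 ∈ F := by
  rw [← IsGalois.fixedField_fixingSubgroup F]
  rintro ⟨g, hg⟩
  have := hf g 1
  rw [(hu.eq_one_iff g).2 hg] at this
  simpa using this.symm

theorem conjugates_of_equivariant {f : N → E}
    (hf : ∀ g n, f (α g n * u g) = g (f n)) (hf1 : f 1 ∈ F) : hu.conjugates ⟨f 1, hf1⟩ = f := by
  ext n
  obtain ⟨g, rfl⟩ := hu.surjective n
  rw [conjugates_apply, ← hf, _root_.map_one, one_mul]

/-- Different points of `N` correspond to different cosets, hence to different embeddings of `F` in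
`E`, and Dedekind's theorem applies. -/
theorem linearIndependent_conjugates [Fintype N] {c : N → E}
    (hc : ∀ t, ∑ n, c n * hu.conjugates t n = 0) : c = 0 := by
  have hli := (linearIndependent_monoidHom F E).comp
    (fun n => ((Pi.evalAlgHom k (fun _ : N => E) n).comp hu.conjugates : F →* E)) (fun m n hmn => by
      obtain ⟨g, rfl⟩ := hu.surjective m
      obtain ⟨h, rfl⟩ := hu.surjective n
      have h1 : ∀ t : F, g t = h t := fun t => by
        rw [← hu.conjugates_apply, ← hu.conjugates_apply]
        exact DFunLike.congr_fun hmn t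
      have h2 : g⁻¹ * h ∈ F.fixingSubgroup := fun t => by
        change g⁻¹ (h t) = t
        rw [← h1]
        simp
      rw [← mul_inv_cancel_left g h, hu.map_mul, (hu.eq_one_iff _).2 h2, _root_.map_one, one_mul])
  funext n
  refine Fintype.linearIndependent_iff.1 hli c ?_ n
  ext t
  simpa using hc t

theorem leftTranslation_conjugates_equivariant (h : groupAlgebraFixed α) (t : F)
    (g : E ≃ₐ[k] E) (n : N) :
    leftTranslation E N (h : MonoidAlgebra E N) (hu.conjugates t) (α g n * u g) =
      g (leftTranslation E N (h : MonoidAlgebra E N) (hu.conjugates t) n) := by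
  conv_lhs => rw [← h.2 g]
  exact leftTranslation_equivariant (hu.conjugates_equivariant t) _ g n

variable [FiniteDimensional k E] [IsGalois k E]

/-- The element of `F` obtained by letting an element of `E[N]^G` act on an element of `F`. -/
noncomputable def actFun (h : groupAlgebraFixed α) (t : F) : F :=
  ⟨leftTranslation E N (h : MonoidAlgebra E N) (hu.conjugates t) 1,
    hu.mem_of_equivariant (hu.leftTranslation_conjugates_equivariant h t)⟩

theorem conjugates_actFun (h : groupAlgebraFixed α) (t : F) :
    hu.conjugates (hu.actFun h t) =
      leftTranslation E N (h : MonoidAlgebra E N) (hu.conjugates t) :=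
  hu.conjugates_of_equivariant (hu.leftTranslation_conjugates_equivariant h t) _

/-- The action of `E[N]^G` on `F`. -/
noncomputable def act : groupAlgebraFixed α →ₐ[k] Module.End k F :=
  AlgHom.ofLinearMap
    (LinearMap.mk₂ k hu.actFun
      (fun h h' t => hu.conjugates_injective <| by simp [conjugates_actFun])
      (fun c h t => hu.conjugates_injective <| by
        ext n
        simp [conjugates_actFun, Algebra.smul_def])
      (fun h t t' => hu.conjugates_injective <| by simp [conjugates_actFun])
      (fun c h t => hu.conjugates_injective <| by
        simp only [conjugates_actFun, map_smul]
        rw [← algebraMap_smul E c (hu.conjugates t), map_smul, algebraMap_smul]))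
    (LinearMap.ext fun t => hu.conjugates_injective <| by simp [conjugates_actFun])
    (fun h h' => LinearMap.ext fun t => hu.conjugates_injective <| by simp [conjugates_actFun])

theorem conjugates_act (h : groupAlgebraFixed α) (t : F) :
    hu.conjugates (hu.act h t) = leftTranslation E N (h : MonoidAlgebra E N) (hu.conjugates t) :=
  hu.conjugates_actFun h t

theorem act_one (h : groupAlgebraFixed α) :
    hu.act h 1 = algebraMap k F ((groupAlgebraFixed_isHopfForm α).counit h) :=
  hu.conjugates_injective <| by
    rw [conjugates_act, _root_.map_one, leftTranslation_const, AlgHom.commutes,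
      ← (groupAlgebraFixed_isHopfForm α).algebraMap_counit]
    rfl

theorem act_mul (h : groupAlgebraFixed α) (x y : F) :
    hu.act h (x * y) =
      LinearMap.mul' k F (TensorProduct.map (hu.act.toLinearMap.flip x)
        (hu.act.toLinearMap.flip y) ((groupAlgebraFixed_isHopfForm α).comul h)) :=
  hu.conjugates_injective <| by
    have key : ∀ z : groupAlgebraFixed α ⊗[k] groupAlgebraFixed α,
        hu.conjugates (LinearMap.mul' k F (TensorProduct.map (hu.act.toLinearMap.flip x)
          (hu.act.toLinearMap.flip y) z)) =
        LinearMap.mul' E (N → E) (TensorProduct.map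
          ((leftTranslation E N).toLinearMap.flip (hu.conjugates x))
          ((leftTranslation E N).toLinearMap.flip (hu.conjugates y))
          (IsHopfForm.tensorIncl E (groupAlgebraFixed α) z)) := by
      intro z
      induction z with
      | zero => simp
      | tmul a b => simp [conjugates_act]
      | add a b ha hb => simp only [_root_.map_add, ha, hb]
    rw [conjugates_act, _root_.map_mul, leftTranslation_mul_apply, key,
      IsHopfForm.tensorIncl_comul]

theorem hopfGaloisMap_injective [Finite N] : Function.Injective (hopfGaloisMap hu.act) := by
  have := Fintype.ofFinite N
  have := groupAlgebraFixed_finite (k := k) α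
  rw [injective_iff_map_eq_zero]
  intro z hz
  let b := Module.finBasis k (groupAlgebraFixed α)
  let B := (groupAlgebraFixed_isBaseChange α).basis b
  have hB : ∀ i, B i = b i := (groupAlgebraFixed_isBaseChange α).basis_apply b
  obtain ⟨c, rfl⟩ : ∃ c : _ → F, z = ∑ i, c i ⊗ₜ b i := by
    clear hz
    induction z with
    | zero => exact ⟨0, by simp⟩
    | tmul t h =>
      refine ⟨fun i => b.repr h i • t, ?_⟩
      conv_lhs => rw [← b.sum_repr h]
      simp only [TensorProduct.tmul_sum, TensorProduct.tmul_smul, TensorProduct.smul_tmul']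
    | add x y hx hy =>
      obtain ⟨c, rfl⟩ := hx
      obtain ⟨d, rfl⟩ := hy
      exact ⟨c + d, by simp [TensorProduct.add_tmul, Finset.sum_add_distrib]⟩
  have h1 : ∀ t, ∑ i, c i * hu.act (b i) t = 0 := fun t => by
    simpa [hopfGaloisMap] using LinearMap.congr_fun hz t
  -- Evaluating `h1` at `p` gives a relation between the conjugates of `t`. Its coefficients are
  -- those of this element of `E[N]`, read at `p * m⁻¹`, which runs over all of `N`.
  have h2 : ∀ p : N, ∑ i, hu.conjugates (c i) p • B i = 0 := by
    intro p
    have h3 : (fun m => ∑ i, hu.conjugates (c i) p * (B i).coeff (p * m⁻¹)) = 0 := by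
      apply hu.linearIndependent_conjugates
      intro t
      have h4 := congrFun (congrArg hu.conjugates (h1 t)) p
      simp only [_root_.map_sum, _root_.map_mul, conjugates_act, leftTranslation_apply,
        Finset.sum_apply, Pi.mul_apply, _root_.map_zero, Pi.zero_apply, Finset.mul_sum] at h4
      rw [Finset.sum_comm] at h4
      simpa only [Finset.sum_mul, mul_assoc, hB] using h4
    ext n
    have h5 := congrFun h3 (n⁻¹ * p)
    simpa using h5
  have h6 : ∀ i, c i = 0 := fun i => hu.conjugates_injective <| funext fun p => by
    simpa using Fintype.linearIndependent_iff.1 B.linearIndependent _ (h2 p) i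
  simp [h6]

/-- Both sides of `j` have dimension `|N|²` over `k`. -/
theorem hopfGaloisMap_bijective [Finite N] (hF : Module.finrank k F = Nat.card N) :
    Function.Bijective (hopfGaloisMap hu.act) := by
  have := groupAlgebraFixed_finite (k := k) α
  refine ⟨hu.hopfGaloisMap_injective, (LinearMap.injective_iff_surjective_of_finrank_eq_finrank
    ?_).1 hu.hopfGaloisMap_injective⟩
  rw [Module.finrank_tensorProduct, Module.finrank_linearMap, finrank_groupAlgebraFixed, hF]

end IsRegularCocycle

namespace IsRegularCocycle

variable {k : Type u} {E : Type v} {N : Type} [Field k] [Field E] [Algebra k E] [Group N] [Finite N]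
  [FiniteDimensional k E] [IsGalois k E]
  {F : IntermediateField k E} {α : (E ≃ₐ[k] E) →* MulAut N} {u : (E ≃ₐ[k] E) → N}
  (hu : IsRegularCocycle F α u) (hF : Module.finrank k F = Nat.card N)

/-- The Hopf Galois structure on `F/k` with Hopf algebra `E[N]^G` attached to a regular
cocycle. -/
noncomputable def hopfGaloisStructure : HopfGaloisStructure k F :=
  letI := (groupAlgebraFixed_isHopfForm α).hopfAlgebra
  haveI := (groupAlgebraFixed_isHopfForm α).isCocomm
  haveI := groupAlgebraFixed_finite (k := k) α
  { H := groupAlgebraFixed α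
    act := hu.act
    act_one := hu.act_one
    act_mul := hu.act_mul
    bijective := hu.hopfGaloisMap_bijective hF }

theorem hopfGaloisStructure_hasType : (hu.hopfGaloisStructure hF).HasType E N :=
  ⟨(groupAlgebraFixed_isHopfForm α).baseChangeEquiv⟩

end IsRegularCocycle

/-! ### Distinguishing structures by their type -/

namespace HopfGaloisStructure

variable {k : Type u} {F : Type v} [Field k] [Field F] [Algebra k F]

theorem HasType.commute {S : HopfGaloisStructure k F} {E : Type v} [Field E] [Algebra k E]
    {N : Type w} [CommGroup N] (hS : S.HasType E N) (x y : S.H) : Commute x y := by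
  obtain ⟨e⟩ := hS
  apply Module.FaithfullyFlat.tensorProduct_mk_injective (A := k) (B := E) S.H
  apply e.injective
  have h : ∀ z : S.H, TensorProduct.mk k E S.H 1 z =
    (Algebra.TensorProduct.includeRight : S.H →ₐ[k] E ⊗[k] S.H) z := fun _ => rfl
  rw [h, h, map_mul, map_mul, map_mul, map_mul, mul_comm]

theorem HasType.mul_comm_of_commute {S : HopfGaloisStructure k F} {E : Type v} [Field E]
    [Algebra k E] {N : Type w} [Group N] (hS : S.HasType E N) (h : ∀ x y : S.H, Commute x y)
    (m n : N) : m * n = n * m := by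
  obtain ⟨e⟩ := hS
  have h1 : ∀ a b : E ⊗[k] S.H, a * b = b * a := by
    intro a b
    induction a with
    | zero => simp
    | add a₁ a₂ h₁ h₂ => rw [add_mul, mul_add, h₁, h₂]
    | tmul s x =>
      induction b with
      | zero => simp
      | add b₁ b₂ h₁ h₂ => rw [add_mul, mul_add, h₁, h₂]
      | tmul t y => rw [Algebra.TensorProduct.tmul_mul_tmul, Algebra.TensorProduct.tmul_mul_tmul,
          mul_comm s t, (h x y).eq]
  apply MonoidAlgebra.of_injective (R := E)
  rw [map_mul, map_mul]
  apply e.symm.injective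
  rw [map_mul, map_mul, h1]

/-- Commutativity of the Hopf algebra is invariant under equivalence and, by base change to `E`,
amounts to commutativity of the type. -/
theorem not_equivalent_of_hasType {S T : HopfGaloisStructure k F} {E : Type v} [Field E]
    [Algebra k E] {N M : Type*} [CommGroup N] [Group M] (hS : S.HasType E N) (hT : T.HasType E M)
    {m n : M} (hmn : m * n ≠ n * m) : ¬ S.Equivalent T := by
  rintro ⟨e, -⟩
  refine hmn (hT.mul_comm_of_commute (fun x y => ?_) m n)
  have := (hS.commute (e.symm x) (e.symm y)).map e
  simpa using this

end HopfGaloisStructure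

/-! ### The affine group of order 20 -/

instance fact_prime_five : Fact (Nat.Prime 5) := ⟨by norm_num⟩

/-- Coordinates identifying a group with the affine group of the line over `ZMod 5`: the linear
part `a` and the translation part `b`. -/
structure AffineCoordinates (G : Type*) [Group G] where
  /-- the linear part -/
  a : G →* ZMod 5
  /-- the translation part -/
  b : G → ZMod 5
  b_mul : ∀ g h, b (g * h) = b g + a g * b h
  exists_eq : ∀ x y : ZMod 5, x ≠ 0 → ∃ g, a g = x ∧ b g = y
  eq_one : ∀ g, a g = 1 → b g = 0 → g = 1

/-- The number of Sylow 5-subgroups divides 4 and is 1 mod 5, so the Sylow subgroup `P` is normal,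
with complement `H`. The translation part of `g` is its `P`-component, and the linear part is the
scalar by which `g` conjugates `P ≅ ZMod 5`. Triviality of the core makes these coordinates
faithful, and `20 = 4 * 5` makes them exhaustive. -/
theorem Subgroup.exists_affineCoordinates {G : Type*} [Group G] (hG : Nat.card G = 20)
    (H : Subgroup G) (hH : Nat.card H = 4) (hcore : ∀ M : Subgroup G, M.Normal → M ≤ H → M = ⊥) :
    ∃ c : AffineCoordinates G, ∀ g, c.b g = 0 ↔ g ∈ H := by
  have : Finite G := Nat.finite_of_card_ne_zero (by omega)
  let P : Sylow 5 G := default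
  have hP : Nat.card P = 5 := by
    rw [P.card_eq_multiplicity, hG]
    have : Nat.factorization 20 5 = 1 := by
      rw [Nat.factorization_def _ (by norm_num)]
      rw [show 20 = 5 * 4 from rfl, padicValNat.mul (by norm_num) (by norm_num)]
      simp [padicValNat.eq_zero_of_not_dvd]
    rw [this, pow_one]
  have hPn : (P : Subgroup G).Normal := by
    have h1 : Nat.card (Sylow 5 G) ≡ 1 [MOD 5] := card_sylow_modEq_one 5 G
    have h2 : Nat.card (Sylow 5 G) ∣ (P : Subgroup G).index := P.card_dvd_index
    have h3 : (P : Subgroup G).index = 4 := by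
      have := (P : Subgroup G).card_mul_index
      rw [hG, show Nat.card (P : Subgroup G) = 5 from hP] at this
      omega
    rw [h3] at h2
    have h4 := Nat.le_of_dvd (by norm_num) h2
    have h5 : Nat.card (Sylow 5 G) = 1 := by
      unfold Nat.ModEq at h1
      omega
    have := (Nat.card_eq_one_iff_unique.1 h5).1
    exact P.normal_of_subsingleton
  have hcyc : IsCyclic P := isCyclic_of_prime_card hP
  obtain ⟨σ, hσ⟩ := hcyc.exists_generator
  have hord : orderOf (σ : G) = 5 := by
    rw [Subgroup.orderOf_coe, orderOf_eq_card_of_forall_mem_zpowers hσ, hP]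
  let τ : ZMod 5 → G := fun x => (σ : G) ^ x.val
  have hτn : ∀ n : ℕ, τ n = (σ : G) ^ n := fun n => by
    simp only [τ, ZMod.val_natCast]
    have := pow_mod_orderOf (σ : G) n
    rwa [hord] at this
  have hτadd : ∀ x y, τ (x + y) = τ x * τ y := fun x y => by
    rw [← ZMod.natCast_zmod_val x, ← ZMod.natCast_zmod_val y, ← Nat.cast_add, hτn, hτn,
      hτn, pow_add]
  have hτ0 : τ 0 = 1 := by simp [τ]
  have hτmem : ∀ x, τ x ∈ P := fun x => Subgroup.pow_mem _ σ.2 _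
  have hτinj : Function.Injective τ := fun x y hxy => by
    apply ZMod.val_injective
    exact pow_injOn_Iio_orderOf (by simpa [hord] using ZMod.val_lt x)
      (by simpa [hord] using ZMod.val_lt y) hxy
  have hτsurj : ∀ p ∈ P, ∃ x, τ x = p := by
    intro p hp
    obtain ⟨n, hn⟩ := (mem_powers_iff_mem_zpowers).2 (hσ ⟨p, hp⟩)
    exact ⟨n, by rw [hτn]; exact congrArg Subtype.val hn⟩
  have hcompl : (P : Subgroup G).IsComplement' H :=
    Subgroup.isComplement'_of_coprime (by
      rw [hP, hH, hG]) (by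
      rw [hP, hH]; norm_num)
  have hτH : ∀ x, τ x ∈ H → x = 0 := fun x hx => by
    apply hτinj
    rw [hτ0]
    exact Subgroup.disjoint_def.1 hcompl.disjoint (hτmem x) hx
  have hb : ∀ g : G, ∃ x, (τ x)⁻¹ * g ∈ H := by
    intro g
    obtain ⟨⟨p, h⟩, hph⟩ := hcompl.2 g
    obtain ⟨x, hx⟩ := hτsurj p p.2
    refine ⟨x, ?_⟩
    rw [hx, ← hph]
    simp
  have ha : ∀ g : G, ∃ c : ZMod 5, ∀ x, g * τ x = τ (c * x) * g := by
    intro g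
    obtain ⟨c, hc⟩ := hτsurj _ (hPn.conj_mem σ σ.2 g)
    refine ⟨c, fun x => ?_⟩
    rw [← mul_inv_eq_iff_eq_mul]
    simp only [τ]
    rw [← conj_pow, ← hc, ← hτn (c * x).val]
    simp only [τ]
    rw [← pow_mul, ← hτn, Nat.cast_mul, ZMod.natCast_zmod_val, ZMod.natCast_zmod_val,
      ZMod.natCast_zmod_val]
  choose a ha using ha
  choose b hb using hb
  have ha_unique : ∀ g c, (g * τ 1 = τ c * g) → a g = c := fun g c h => by
    rw [ha, mul_one, mul_left_inj] at h
    exact hτinj h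
  have hb_unique : ∀ g x, (τ x)⁻¹ * g ∈ H → b g = x := fun g x h => by
    have h1 := H.mul_mem (hb g) (H.inv_mem h)
    have h2 : τ (x - b g) ∈ H := by
      have h3 : τ (x - b g) = (τ (b g))⁻¹ * τ x := by
        rw [eq_inv_mul_iff_mul_eq, ← hτadd, add_sub_cancel]
      rw [h3]
      simpa [mul_assoc] using h1
    exact (sub_eq_zero.1 (hτH _ h2)).symm
  let A : G →* ZMod 5 :=
    { toFun := a
      map_one' := ha_unique _ _ (by simp)
      map_mul' := fun g h => ha_unique _ _ (by
        rw [mul_assoc, ha, ← mul_assoc, ha, mul_one, mul_assoc]) }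
  have hbH : ∀ g, b g = 0 ↔ g ∈ H := fun g =>
    ⟨fun h => by simpa [h, hτ0] using hb g, fun h => hb_unique _ _ (by simpa [hτ0])⟩
  have hbmul : ∀ g h, b (g * h) = b g + a g * b h := fun g h => hb_unique _ _ <| by
    have h1 := H.mul_mem (hb g) (hb h)
    rw [add_comm, hτadd, mul_inv_rev]
    convert h1 using 1
    have h2 := ha g (-(b h))
    have h3 : ∀ x, τ (-x) = (τ x)⁻¹ := fun x => by
      rw [eq_inv_iff_mul_eq_one, ← hτadd, neg_add_cancel, hτ0]
    rw [mul_neg, h3, h3] at h2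
    rw [mul_assoc, mul_assoc, ← mul_assoc g, h2, mul_assoc]
  have hone : ∀ g, a g = 1 → b g = 0 → g = 1 := by
    intro g hag hbg
    -- Elements of `H` centralizing `P`: with linear part 1 and translation part 0, their conjugates
    -- again have translation part 0, so they form a normal subgroup inside `H`.
    let M : Subgroup G := A.ker ⊓ H
    have hM : M.Normal := ⟨fun n hn g => by
      refine ⟨(inferInstance : A.ker.Normal).conj_mem n hn.1 g, (hbH _).1 ?_⟩
      have h1 : a n = 1 := hn.1
      have h2 : b (g * g⁻¹) = 0 := by rw [mul_inv_cancel, hbH]; exact H.one_mem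
      rw [mul_assoc, hbmul, hbmul, (hbH n).2 hn.2, h1, zero_add, one_mul, ← hbmul, h2]⟩
    have h3 := hcore M hM inf_le_right
    have h4 : g ∈ M := ⟨hag, (hbH g).1 hbg⟩
    rwa [h3, Subgroup.mem_bot] at h4
  have hbij : Function.Bijective (fun g : G => (A.toHomUnits g, b g)) := by
    rw [Nat.bijective_iff_injective_and_card]
    refine ⟨fun g h hgh => ?_, ?_⟩
    · have h1 : a g = a h := congrArg (fun x => (x.1 : ZMod 5)) hgh
      have h2 : b g = b h := congrArg Prod.snd hgh
      have h3 : A (g⁻¹ * h) = 1 := by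
        rw [map_mul, show A h = A g from h1.symm, ← map_mul, inv_mul_cancel, map_one]
      have h4 : b (g⁻¹ * h) = 0 := by
        have h5 := hbmul g (g⁻¹ * h)
        rw [mul_inv_cancel_left, h2, left_eq_add] at h5
        exact (mul_eq_zero.1 h5).resolve_left (A.toHomUnits g).ne_zero
      exact inv_mul_eq_one.1 (hone _ h3 h4)
    · rw [hG, Nat.card_prod, Nat.card_eq_fintype_card, Nat.card_eq_fintype_card, ZMod.card,
        ZMod.card_units]
  refine ⟨⟨A, b, hbmul, fun x y hx => ?_, hone⟩, hbH⟩
  obtain ⟨g, hg⟩ := hbij.2 (Units.mk0 x hx, y)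
  exact ⟨g, congrArg (fun x => (x.1 : ZMod 5)) hg, congrArg Prod.snd hg⟩

namespace AffineCoordinates

variable {G : Type*} [Group G] (c : AffineCoordinates G)

theorem a_ne_zero (g : G) : c.a g ≠ 0 := (c.a.toHomUnits g).ne_zero

theorem b_one : c.b 1 = 0 := by simpa using c.b_mul 1 1

theorem ext_iff {g h : G} : g = h ↔ c.a g = c.a h ∧ c.b g = c.b h := by
  refine ⟨fun h => h ▸ ⟨rfl, rfl⟩, fun ⟨ha, hb⟩ => ?_⟩
  have h3 : c.a (g⁻¹ * h) = 1 := by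
    rw [map_mul, ← ha, ← map_mul, inv_mul_cancel, map_one]
  have h5 := c.b_mul g (g⁻¹ * h)
  rw [mul_inv_cancel_left, hb, left_eq_add] at h5
  exact inv_mul_eq_one.1 (c.eq_one _ h3 ((mul_eq_zero.1 h5).resolve_left (c.a_ne_zero g)))

/-- In the affine group of the line over `ZMod 5`, the action on the cosets of the subgroup of
homotheties of ratio `±1` does not contain a regular subgroup. -/
theorem not_isRegularSubgroup_of_le_range {G' : Subgroup G} (hG : Nat.card G = 20)
    (hG' : G'.index = 10) (h : ∀ g, g ∈ G' ↔ c.b g = 0 ∧ c.a g ^ 2 = 1)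
    {N : Subgroup (Equiv.Perm (G ⧸ G'))} (hN : N ≤ (MulAction.toPermHom G (G ⧸ G')).range) :
    ¬ IsRegularSubgroup N := by
  intro hreg
  let ρ := MulAction.toPermHom G (G ⧸ G')
  have hρ : ∀ g x : G, ρ g (x : G ⧸ G') = ((g * x : G) : G ⧸ G') := fun _ _ => rfl
  have hρ_inj : Function.Injective ρ := by
    rw [injective_iff_map_eq_one]
    intro g hg
    -- Since `c.b` is constant on cosets of `G'`, an element acting trivially preserves it under
    -- left multiplication. Testing on `1` gives `c.b g = 0`, and testing on the translation `x`
    -- gives `c.a g = 1`.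
    obtain ⟨x, hx, hx'⟩ := c.exists_eq 1 1 one_ne_zero
    have h1 : ∀ y : G, c.b (g * y) = c.b y := by
      intro y
      have h2 : ((g * y : G) : G ⧸ G') = (y : G ⧸ G') := by rw [← hρ, hg]; rfl
      have h3 := ((h _).1 (QuotientGroup.eq.1 h2.symm)).1
      have h4 := c.b_mul y (y⁻¹ * (g * y))
      rwa [h3, mul_zero, add_zero, mul_inv_cancel_left] at h4
    have h5 : c.b g = 0 := by simpa [c.b_one] using h1 1
    refine c.eq_one g ?_ h5
    have h6 := h1 x
    rwa [c.b_mul, h5, hx', zero_add, mul_one] at h6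
  have hcard : Nat.card N = 10 := by
    rw [← hG', Subgroup.index]
    refine Nat.card_congr (Equiv.ofBijective
      (fun n : N => (n : Equiv.Perm (G ⧸ G')) ((1 : G) : G ⧸ G')) ⟨fun m n hmn => ?_, fun x => ?_⟩)
    · exact Subtype.ext ((hreg _ _).unique ⟨m.2, rfl⟩ ⟨n.2, hmn.symm⟩)
    · obtain ⟨n, ⟨hn, hnx⟩, -⟩ := hreg ((1 : G) : G ⧸ G') x
      exact ⟨⟨n, hn⟩, hnx⟩
  have hindex : (N.comap ρ).index = 2 := by
    have h1 := (N.comap ρ).card_mul_index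
    have h2 : Nat.card (N.comap ρ) = 10 := by
      rw [← hcard, ← Subgroup.card_map_of_injective hρ_inj, Subgroup.map_comap_eq_self hN]
    rw [h2, hG] at h1
    omega
  -- As 2 has order 4 mod 5, the square of this homothety is `t ↦ -t`: a nontrivial element of `G'`
  -- that lies in every subgroup of index 2.
  obtain ⟨g, hg, hg'⟩ := c.exists_eq 2 0 (by decide)
  have h1 : ρ (g ^ 2) ∈ N := Subgroup.sq_mem_of_index_two hindex g
  have ha : c.a (g ^ 2) = -1 := by rw [map_pow, hg]; decide
  have hb : c.b (g ^ 2) = 0 := by rw [pow_two, c.b_mul, hg', mul_zero, add_zero]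
  have h2 : ρ (g ^ 2) ((1 : G) : G ⧸ G') = ((1 : G) : G ⧸ G') := by
    rw [hρ, mul_one]
    refine QuotientGroup.eq.2 ?_
    rw [mul_one, inv_mem_iff, h, ha, hb]
    exact ⟨rfl, by decide⟩
  have h3 := (hreg _ _).unique ⟨h1, h2⟩ ⟨N.one_mem, rfl⟩
  rw [← map_one ρ] at h3
  rw [hρ_inj h3, map_one] at ha
  exact absurd ha (by decide)

/-! ### The cyclic cocycle -/

/-- The multiplicative section of the reduction `ZMod 10 → ZMod 5` with odd values. -/
def oddLift : ZMod 5 →* ZMod 10 where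
  toFun x := (6 * x.val + 5 : ℕ)
  map_one' := by decide
  map_mul' := by decide

/-- The action of the affine group on the cyclic group of order `10` through the linear part. -/
def cyclicAction : G →* MulAut (Multiplicative (ZMod 10)) where
  toFun g := MonoidHom.toMulEquiv
    (AddMonoidHom.toMultiplicative (AddMonoidHom.mulLeft (oddLift (c.a g))))
    (AddMonoidHom.toMultiplicative (AddMonoidHom.mulLeft (oddLift (c.a g⁻¹))))
    (by ext; simp [← mul_assoc, ← map_mul, inv_mul_cancel₀ (c.a_ne_zero g)])
    (by ext; simp [← mul_assoc, ← map_mul, mul_inv_cancel₀ (c.a_ne_zero g)])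
  map_one' := by ext; simp
  map_mul' g h := by ext; simp [mul_assoc]

/-- The crossed homomorphism identifying the cyclic group of order `10` with the cosets of the
homotheties of ratio `±1`, in coordinates. -/
def cyclicCoord (x y : ZMod 5) : ZMod 10 :=
  (6 * y.val + if x ^ 2 = 1 then 0 else 5 : ℕ)

/-- The crossed homomorphism identifying the cyclic group of order `10` with the cosets of the
homotheties of ratio `±1`. -/
def cyclicCocycle (g : G) : Multiplicative (ZMod 10) :=
  Multiplicative.ofAdd (cyclicCoord (c.a g) (c.b g))

/-- In `ZMod 10` the idempotents 6 and 5 split off the factors `ZMod 5` and `ZMod 2`. The coordinate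
is `y` on the first and the quadratic character of `x`, written additively, on the second; `oddLift
x` multiplies by `x` on the first and acts trivially on the second. -/
theorem cyclicCoord_mul : ∀ x y x' y' : ZMod 5, x ≠ 0 → x' ≠ 0 →
    cyclicCoord (x * x') (y + x * y') = oddLift x * cyclicCoord x' y' + cyclicCoord x y := by
  decide +kernel

theorem cyclicCoord_surjective : ∀ n : ZMod 10, ∃ x y : ZMod 5, x ≠ 0 ∧ cyclicCoord x y = n := by
  decide

theorem cyclicCoord_eq_zero : ∀ x y : ZMod 5, cyclicCoord x y = 0 ↔ y = 0 ∧ x ^ 2 = 1 := by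
  decide

theorem cyclicCocycle_mul (g h : G) :
    c.cyclicCocycle (g * h) = c.cyclicAction g (c.cyclicCocycle h) * c.cyclicCocycle g := by
  apply Multiplicative.toAdd.injective
  simp only [cyclicCocycle, map_mul, c.b_mul,
    cyclicCoord_mul _ _ _ _ (c.a_ne_zero g) (c.a_ne_zero h)]
  rfl

theorem cyclicCocycle_surjective : Function.Surjective c.cyclicCocycle := by
  intro n
  obtain ⟨x, y, hx, hxy⟩ := cyclicCoord_surjective n.toAdd
  obtain ⟨g, rfl, rfl⟩ := c.exists_eq x y hx
  exact ⟨g, hxy⟩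

theorem cyclicCocycle_eq_one (g : G) :
    c.cyclicCocycle g = 1 ↔ c.b g = 0 ∧ c.a g ^ 2 = 1 := by
  rw [← cyclicCoord_eq_zero, cyclicCocycle, ofAdd_eq_one]

/-! ### The dihedral cocycle -/

/-- The endomorphism of the dihedral group of order `10`, viewed as the group of affine maps of
linear part `±1`, given by conjugation by the affine map `t ↦ x t + y`. -/
def dihedralEnd (x y : ZMod 5) : DihedralGroup 5 →* DihedralGroup 5 where
  toFun
    | .r i => .r (x * i)
    | .sr i => .sr (x * i - 2 * y)
  map_one' := congrArg DihedralGroup.r (mul_zero x)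
  map_mul' := by
    rintro (i | i) (j | j) <;> simp <;> ring

@[simp]
theorem dihedralEnd_r (x y i : ZMod 5) : dihedralEnd x y (.r i) = .r (x * i) := rfl

@[simp]
theorem dihedralEnd_sr (x y i : ZMod 5) : dihedralEnd x y (.sr i) = .sr (x * i - 2 * y) := rfl

theorem dihedralEnd_comp (x y x' y' : ZMod 5) :
    (dihedralEnd x y).comp (dihedralEnd x' y') = dihedralEnd (x * x') (y + x * y') := by
  ext (i | i) <;> simp <;> ring

theorem dihedralEnd_one : dihedralEnd 1 0 = MonoidHom.id _ := by
  ext (i | i) <;> simp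

/-- The action of the affine group by conjugation on the dihedral group of order `10`. -/
def dihedralAction : G →* MulAut (DihedralGroup 5) where
  toFun g := MonoidHom.toMulEquiv (dihedralEnd (c.a g) (c.b g)) (dihedralEnd (c.a g⁻¹) (c.b g⁻¹))
    (by rw [dihedralEnd_comp, ← map_mul, ← c.b_mul, inv_mul_cancel, map_one, b_one,
      dihedralEnd_one])
    (by rw [dihedralEnd_comp, ← map_mul, ← c.b_mul, mul_inv_cancel, map_one, b_one,
      dihedralEnd_one])
  map_one' := MulEquiv.ext fun n => by
    simp [b_one, dihedralEnd_one]
  map_mul' g h := MulEquiv.ext fun n => by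
    simp [c.b_mul, ← dihedralEnd_comp]

@[simp]
theorem dihedralAction_apply (g : G) (n : DihedralGroup 5) :
    c.dihedralAction g n = dihedralEnd (c.a g) (c.b g) n := rfl

/-- The crossed homomorphism identifying the dihedral group of order `10` with the cosets of the
homotheties of ratio `±1`. -/
def dihedralCocycle (g : G) : DihedralGroup 5 :=
  if c.a g ^ 2 = 1 then .r (c.b g) else .sr (-c.b g)

/-- Read `.r i` as `t ↦ t + i` and `.sr i` as `t ↦ -t - i`. As squares of units mod 5 are `±1`, the
cocycle sends `t ↦ a t + b` to `t ↦ a² t + b`, that is, to `g` composed with the homothety of ratio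
`a`; the cocycle identity follows by composing affine maps. -/
theorem dihedralCocycle_mul (g h : G) :
    c.dihedralCocycle (g * h) = c.dihedralAction g (c.dihedralCocycle h) * c.dihedralCocycle g := by
  have key : ∀ x y : ZMod 5, x ≠ 0 → y ≠ 0 → ((x * y) ^ 2 = 1 ↔ (x ^ 2 = 1 ↔ y ^ 2 = 1)) := by
    decide
  have hk := key _ _ (c.a_ne_zero g) (c.a_ne_zero h)
  simp only [dihedralCocycle, map_mul, hk, c.b_mul]
  by_cases h1 : c.a g ^ 2 = 1 <;> by_cases h2 : c.a h ^ 2 = 1 <;>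
    simp [h1, h2] <;> ring

theorem dihedralCocycle_surjective : Function.Surjective c.dihedralCocycle := by
  rintro (i | i)
  · obtain ⟨g, hg, hg'⟩ := c.exists_eq 1 i one_ne_zero
    exact ⟨g, by simp [dihedralCocycle, hg, hg']⟩
  -- Any non-square linear part would do for a reflection; here `2 ^ 2 = -1`.
  · obtain ⟨g, hg, hg'⟩ := c.exists_eq 2 (-i) (by decide)
    refine ⟨g, ?_⟩
    rw [dihedralCocycle, hg, hg', if_neg (by decide), neg_neg]

theorem dihedralCocycle_eq_one (g : G) :
    c.dihedralCocycle g = 1 ↔ c.b g = 0 ∧ c.a g ^ 2 = 1 := by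
  rw [dihedralCocycle, ← DihedralGroup.r_zero]
  by_cases h : c.a g ^ 2 = 1 <;>
    simp only [h, if_true, if_false, DihedralGroup.r.injEq, reduceCtorEq, and_true, and_false]

end AffineCoordinates

/-! ### Galois theory of the normal closure -/

section NormalClosure

variable {k E : Type*} [Field k] [Field E] [Algebra k E]

theorem IsNormalClosure.isGalois (K : IntermediateField k E) [Algebra.IsSeparable k K]
    [IsNormalClosure k K E] : IsGalois k E := by
  have : Normal k E := IsNormalClosure.normal (K := K)
  have h := IsNormalClosure.adjoin_rootSet (F := k) (K := K) (L := E)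
  have hsep : Algebra.IsSeparable k E := by
    have h1 : ∀ x : K,
        IntermediateField.adjoin k ((minpoly k x).rootSet E) ≤ separableClosure k E := by
      intro x
      rw [IntermediateField.adjoin_le_iff]
      intro r hr
      have hr' := (Polynomial.mem_rootSet.1 hr).2
      have h2 := minpoly.eq_of_irreducible_of_monic
        (minpoly.irreducible (Algebra.IsIntegral.isIntegral (R := k) x)) hr'
        (minpoly.monic (Algebra.IsIntegral.isIntegral x))
      rw [SetLike.mem_coe, mem_separableClosure_iff, IsSeparable, ← h2]
      exact Algebra.IsSeparable.isSeparable k x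
    have h2 : separableClosure k E = ⊤ := top_le_iff.1 (h ▸ iSup_le h1)
    exact (separableClosure.eq_top_iff k E).1 h2
  exact ⟨⟩

theorem IsNormalClosure.finiteDimensional (K : IntermediateField k E) [IsNormalClosure k K E]
    [FiniteDimensional k K] : FiniteDimensional k E := by
  have h := ((Algebra.IsAlgebraic.isNormalClosure_iff (F := k) (K := K) (L := E)).1 inferInstance).2
  have h1 : FiniteDimensional k (IntermediateField.normalClosure k K E) := inferInstance
  rw [h] at h1
  exact IntermediateField.topEquiv.toLinearEquiv.finiteDimensional

/-- A normal subgroup fixing `K` fixes every conjugate of every element of `K`, and these conjugates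
generate `E`. -/
theorem IsNormalClosure.eq_bot_of_normal_of_le (K : IntermediateField k E)
    [IsNormalClosure k K E] (M : Subgroup (E ≃ₐ[k] E)) (hM : M.Normal)
    (hMK : M ≤ K.fixingSubgroup) : M = ⊥ := by
  have : Normal k E := IsNormalClosure.normal (K := K)
  rw [eq_bot_iff]
  intro g hg
  have h := IsNormalClosure.adjoin_rootSet (F := k) (K := K) (L := E)
  have h1 : (⊤ : IntermediateField k E) ≤ IntermediateField.fixedField M := by
    rw [← h]
    refine iSup_le fun x => ?_
    rw [IntermediateField.adjoin_le_iff]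
    intro r hr
    have hr' := (Polynomial.mem_rootSet.1 hr).2
    have h2 := minpoly.eq_of_irreducible_of_monic
        (minpoly.irreducible (Algebra.IsIntegral.isIntegral (R := k) x)) hr'
        (minpoly.monic (Algebra.IsIntegral.isIntegral x))
    have h3 : minpoly k r = minpoly k (x : E) := by
      rw [← h2, ← minpoly.algebraMap_eq (algebraMap K E).injective]; rfl
    obtain ⟨σ, hσ⟩ := (Normal.minpoly_eq_iff_mem_orbit E).1 h3
    rintro ⟨g, hg⟩
    have h4 := hMK (hM.conj_mem g hg σ⁻¹) x
    have h5 : σ (x : E) = r := hσ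
    have h6 : σ⁻¹ (g (σ (x : E))) = x := by simpa using h4
    rw [h5] at h6
    have h7 := congrArg σ h6
    change g r = r
    simpa [h5] using h7
  rw [Subgroup.mem_bot]
  ext y
  exact h1 (IntermediateField.mem_top (x := y)) ⟨g, hg⟩

end NormalClosure

/-! ### The main theorem -/

theorem mainTheorem4 {k : Type u} {E : Type v} [Field k] [Field E] [Algebra k E]
    (K : IntermediateField k E) [Algebra.IsSeparable k K] (hK : Module.finrank k K = 5)
    [IsNormalClosure k K E] (hE : Nat.card (E ≃ₐ[k] E) = 20)
    (F : IntermediateField k E) (hKF : K < F) (hF : F < ⊤) :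
    Module.finrank k F = 10 ∧
    IsHopfGalois k F ∧
    ¬ IsAlmostClassicallyGalois F ∧
    ∃ S T : HopfGaloisStructure k F,
      S.HasType E (Multiplicative (ZMod 10)) ∧
      T.HasType E (DihedralGroup 5) ∧
      ¬ S.Equivalent T := by
  have : FiniteDimensional k K := FiniteDimensional.of_finrank_pos (by omega)
  have : FiniteDimensional k E := IsNormalClosure.finiteDimensional K
  have : IsGalois k E := IsNormalClosure.isGalois K
  have hkE : Module.finrank k E = 20 := by rw [← IsGalois.card_aut_eq_finrank, hE]
  have hKE : Module.finrank K E = 4 := by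
    have := Module.finrank_mul_finrank k K E
    rw [hK, hkE] at this
    omega
  have hKcard : Nat.card K.fixingSubgroup = 4 := by
    rw [IsGalois.card_fixingSubgroup_eq_finrank, hKE]
  obtain ⟨c, hc⟩ := Subgroup.exists_affineCoordinates hE K.fixingSubgroup hKcard
    (IsNormalClosure.eq_bot_of_normal_of_le K)
  have hFE : Module.finrank F E = 2 := by
    have h1 : Module.finrank F E ∣ 4 := by
      rw [← IsGalois.card_fixingSubgroup_eq_finrank, ← hKcard]
      exact Subgroup.card_dvd_of_le (IntermediateField.fixingSubgroup_antitone hKF.le)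
    have h2 : Module.finrank F E ≠ 1 := fun h =>
      hF.ne (IntermediateField.finrank_eq_one_iff_eq_top.1 h)
    have h3 : Module.finrank F E ≠ 4 := fun h =>
      hKF.ne (IntermediateField.eq_of_le_of_finrank_eq' hKF.le (hKE.trans h.symm))
    have h4 := Nat.le_of_dvd (by norm_num) h1
    interval_cases Module.finrank F E <;> omega
  have hkF : Module.finrank k F = 10 := by
    have := Module.finrank_mul_finrank k F E
    rw [hFE, hkE] at this
    omega
  have hFcard : Nat.card F.fixingSubgroup = 2 := by
    rw [IsGalois.card_fixingSubgroup_eq_finrank, hFE]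
  -- The only homotheties of ratio `±1` are the identity and `t ↦ -t`, and the nontrivial element of
  -- the order 2 group `Gal(E/F)` must be the latter.
  have hF_mem : ∀ g, g ∈ F.fixingSubgroup ↔ c.b g = 0 ∧ c.a g ^ 2 = 1 := by
    have hle : F.fixingSubgroup ≤ K.fixingSubgroup :=
      IntermediateField.fixingSubgroup_antitone hKF.le
    have hfor : ∀ g ∈ F.fixingSubgroup, c.b g = 0 ∧ c.a g ^ 2 = 1 := by
      intro g hg
      refine ⟨(hc g).2 (hle hg), ?_⟩
      have h1 : (⟨g, hg⟩ : F.fixingSubgroup) ^ 2 = 1 := hFcard ▸ pow_card_eq_one'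
      have h2 : g ^ 2 = 1 := congrArg Subtype.val h1
      rw [← map_pow, h2, map_one]
    have eq_or_neg : ∀ x : ZMod 5, x ^ 2 = 1 → x = 1 ∨ x = -1 := by decide
    intro g
    refine ⟨hfor g, fun ⟨hb, ha⟩ => ?_⟩
    have : Nontrivial F.fixingSubgroup := Finite.one_lt_card_iff_nontrivial.1 (by omega)
    obtain ⟨⟨σ, hσ⟩, hσ1⟩ := exists_ne (1 : F.fixingSubgroup)
    obtain ⟨hσb, hσa⟩ := hfor σ hσ
    rcases eq_or_neg _ ha with h | h
    · rw [c.eq_one g h hb]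
      exact one_mem _
    · have h1 : c.a σ = -1 := (eq_or_neg _ hσa).resolve_left fun h =>
        hσ1 (Subtype.ext (c.eq_one σ h hσb))
      rwa [c.ext_iff.2 ⟨h.trans h1.symm, hb.trans hσb.symm⟩]
  have hcyc : IsRegularCocycle F c.cyclicAction c.cyclicCocycle :=
    ⟨c.cyclicCocycle_mul, c.cyclicCocycle_surjective, fun g =>
      (c.cyclicCocycle_eq_one g).trans (hF_mem g).symm⟩
  have hdih : IsRegularCocycle F c.dihedralAction c.dihedralCocycle :=
    ⟨c.dihedralCocycle_mul, c.dihedralCocycle_surjective, fun g =>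
      (c.dihedralCocycle_eq_one g).trans (hF_mem g).symm⟩
  have hcycF : Module.finrank k F = Nat.card (Multiplicative (ZMod 10)) := by
    rw [hkF, Nat.card_eq_fintype_card]; rfl
  have hdihF : Module.finrank k F = Nat.card (DihedralGroup 5) := by
    rw [hkF, DihedralGroup.nat_card]
  refine ⟨hkF, ⟨hcyc.hopfGaloisStructure hcycF⟩, ?_, hcyc.hopfGaloisStructure hcycF,
    hdih.hopfGaloisStructure hdihF, hcyc.hopfGaloisStructure_hasType hcycF,
    hdih.hopfGaloisStructure_hasType hdihF,
    HopfGaloisStructure.not_equivalent_of_hasType (hcyc.hopfGaloisStructure_hasType hcycF)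
      (hdih.hopfGaloisStructure_hasType hdihF) (m := .r 1) (n := .sr 0) (by decide)⟩
  rintro ⟨N, hN, -, hNle⟩
  refine c.not_isRegularSubgroup_of_le_range hE ?_ hF_mem hNle hN
  have := F.fixingSubgroup.card_mul_index
  rw [hFcard, hE] at this
  omega
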